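/- Let $\mathbf{k}$ be a field of characteristic $0$, let $\mathbf{k}\subset\mathbf{K}$ be a field extension, and let $r\ge 0$ be an integer. A \emph{filtered dga} over $\mathbf{k}$ is a non-negatively graded, graded-commutative unital differential graded $\mathbf{k}$-algebra $(A,d)$ (with $d$ of degree $1$), together with an increasing filtration $W$ by graded subcomplexes $W_pA$, $p\in\mathbb{Z}$, such that $1\in W_0A$ and $W_pA\cdot W_qA\subset W_{p+q}A$. The filtration is required to be exhaustive ($A=\bigcup_p W_pA$) and regular (for each $n\geq 0$ there is $q\in\mathbb{Z}$ with $W_qA^n=0$). Morphisms are morphisms of dga's preserving the filtrations. An \emph{$E_r$-cofibrant extension of $A$ of degree $n\ge 0$ and weight $p\in\mathbb{Z}$} is a filtered dga $A\otimes_\xi\Lambda V$, where $V$ is a vector space in pure degree $n$ and pure weight $p$, $\Lambda V$ is the free graded-commutative algebra on $V$, and $\xi:V\to W_{p-r}A^{n+1}$ is a linear map with $d\circ\xi=0$; the differential ($d|_V=\xi$) and the filtration are defined by multiplicative extension. A filtered dga is \emph{$E_r$-cofibrant} if it is the colimit of a sequence of $E_r$-cofibrant extensions starting from the base field $\mathbf{k}$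 (with trivial filtration, in weight $0$). It is \emph{finitely generated} if it is so as a $\mathbf{k}$-algebra. An \emph{$r$-splitting} of a filtered dga $A$ is a direct sum decomposition $A=\bigoplus_{p,q\in\mathbb{Z}}A^{p,q}$ into subspaces such that for all $p,q,p',q',m\in\mathbb{Z}$ and all $n\ge 0$, $$d(A^{p,q})\subset A^{p+r,q-r+1},\qquad A^{p,q}\cdot A^{p',q'}\subset A^{p+p',q+q'},\qquad W_mA^n=\bigoplus_{p\leq m}A^{-p,n+p}.$$ A morphism $f:A\to B$ of filtered dga's \emph{admits an $r$-splitting} if there are $r$-splittings of $A$ and $B$ such that $f(A^{p,q})\subset B^{p,q}$ for all $p,q$. \textbf{Theorem.} Let $f:A\to B$ be a morphism of finitely generated $E_r$-cofibrant filtered dga's over $\mathbf{k}$. Then $f$ admits an $r$-splitting (over $\mathbf{k}$) if and only if $f_{\mathbf{K}}:=f\otimes_{\mathbf{k}}\mathbf{K}:A\otimes_{\mathbf{k}}\mathbf{K}\to B\otimes_{\mathbf{k}}\mathbf{K}$, where $A\otimes_{\mathbf{k}}\mathbf{K}$ and $B\otimes_{\mathbf{k}}\mathbf{K}$ carry the filtrations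 $W\otimes_{\mathbf{k}}\mathbf{K}$, admits an $r$-splitting (over $\mathbf{K}$). -/

import Mathlib

universe u v

open scoped TensorProduct

/-- A filtered differential graded commutative algebra over `k`: a non-negatively graded,
graded-commutative, unital associative `k`-algebra with a differential of degree `1`, together with
an increasing multiplicative filtration `W` by graded subcomplexes (the unit map being filtered,
where `k` sits in weight `0`) which is exhaustive and regular. -/
structure FilteredCDGA (k : Type*) [Field k] where
  /-- The underlying algebra. -/
  carrier : Type*
  [ring : Ring carrier]
  [algebra : Algebra k carrier]
  /-- `deg n` is the subspace of elements of degree `n`. -/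
  deg : ℕ → Submodule k carrier
  [graded : GradedAlgebra deg]
  graded_comm : ∀ m n : ℕ, ∀ a ∈ deg m, ∀ b ∈ deg n, a * b = (-1) ^ (m * n) * (b * a)
  /-- The differential. -/
  d : carrier →ₗ[k] carrier
  d_deg : ∀ n : ℕ, ∀ a ∈ deg n, d a ∈ deg (n + 1)
  d_d : ∀ a, d (d a) = 0
  leibniz : ∀ n : ℕ, ∀ a ∈ deg n, ∀ b, d (a * b) = d a * b + (-1) ^ n * (a * d b)
  /-- The increasing filtration. -/
  W : ℤ → Submodule k carrier
  W_mono : Monotone W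
  /-- Each `W p` is a graded subspace: `W p = ⨁ₙ (W p ∩ deg n)`. -/
  W_graded : ∀ p : ℤ, ∀ n : ℕ, ∀ a ∈ W p, GradedAlgebra.proj deg n a ∈ W p
  W_d : ∀ p : ℤ, ∀ a ∈ W p, d a ∈ W p
  W_one : (1 : carrier) ∈ W 0
  W_mul : ∀ p q : ℤ, ∀ a ∈ W p, ∀ b ∈ W q, a * b ∈ W (p + q)
  W_exhaustive : ∀ a, ∃ p : ℤ, a ∈ W p
  W_regular : ∀ n : ℕ, ∃ q : ℤ, W q ⊓ deg n = ⊥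

namespace FilteredCDGA

attribute [instance] ring algebra graded

/-- Morphisms of filtered dga's. -/
structure Hom {k : Type*} [Field k] (A : FilteredCDGA k) (B : FilteredCDGA k) where
  /-- The underlying algebra morphism. -/
  toAlgHom : A.carrier →ₐ[k] B.carrier
  map_deg : ∀ n : ℕ, ∀ a ∈ A.deg n, toAlgHom a ∈ B.deg n
  map_d : ∀ a, toAlgHom (A.d a) = B.d (toAlgHom a)
  map_W : ∀ p : ℤ, ∀ a ∈ A.W p, toAlgHom a ∈ B.W p

section BaseChange

variable {k : Type*} [Field k] (K : Type*) [Field K] [Algebra k K]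

/-- Induction on pure tensors for elements of `S ⊗ K`. -/
theorem baseChange_induction {M : Type*} [AddCommGroup M] [Module k M] {S : Submodule k M}
    {P : K ⊗[k] M → Prop} (zero : P 0) (add : ∀ x y, P x → P y → P (x + y))
    (tmul : ∀ (c : K), ∀ a ∈ S, P (c ⊗ₜ[k] a)) : ∀ x ∈ S.baseChange K, P x := by
  intro x hx
  obtain ⟨y, hy⟩ := Submodule.toBaseChange_surjective K S ⟨x, hx⟩
  obtain rfl : (Submodule.toBaseChange K S y : K ⊗[k] M) = x := by rw [hy]
  clear hx hy
  induction y using TensorProduct.induction_on with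
  | zero => simpa using zero
  | tmul c a => simpa using tmul c a a.2
  | add y z hy hz => simpa using add _ _ hy hz

theorem proj_baseChange (A : FilteredCDGA k) (n : ℕ) (x : K ⊗[k] A.carrier) :
    GradedAlgebra.proj (fun i => (A.deg i).baseChange K) n x
      = (GradedAlgebra.proj A.deg n).baseChange K x := by
  suffices h : GradedAlgebra.proj (fun i => (A.deg i).baseChange K) n
      = (GradedAlgebra.proj A.deg n).baseChange K from LinearMap.congr_fun h x
  apply TensorProduct.AlgebraTensorModule.curry_injective
  ext a
  simp only [TensorProduct.AlgebraTensorModule.curry_apply,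
    TensorProduct.curry_apply, LinearMap.coe_restrictScalars, LinearMap.baseChange_tmul]
  induction a using DirectSum.Decomposition.inductionOn A.deg with
  | zero => simp
  | @homogeneous i a =>
    have ha : (1 : K) ⊗ₜ[k] (a : A.carrier) ∈ (A.deg i).baseChange K :=
      Submodule.tmul_mem_baseChange_of_mem _ a.2
    rw [GradedAlgebra.proj_apply, GradedAlgebra.proj_apply]
    by_cases hin : i = n
    · subst hin
      rw [DirectSum.decompose_of_mem_same (fun i => (A.deg i).baseChange K) ha,
        DirectSum.decompose_of_mem_same _ a.2]
    · rw [DirectSum.decompose_of_mem_ne (fun i => (A.deg i).baseChange K) ha hin,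
        DirectSum.decompose_of_mem_ne _ a.2 hin, TensorProduct.tmul_zero]
  | add a b ha hb => simp only [TensorProduct.tmul_add, map_add, ha, hb]

/-- Extension of scalars `A ⊗ₖ K` of a filtered dga, with grading `deg n ⊗ₖ K`, differential
`d ⊗ₖ K` and filtration `W p ⊗ₖ K`. -/
noncomputable def baseChange (A : FilteredCDGA k) : FilteredCDGA K where
  carrier := K ⊗[k] A.carrier
  deg n := (A.deg n).baseChange K
  graded := GradedAlgebra.baseChange A.deg
  graded_comm m n := by
    refine baseChange_induction K (by simp) (fun x y hx hy b hb => ?_) (fun c a ha => ?_)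
    · rw [add_mul, hx b hb, hy b hb, mul_add, mul_add]
    · refine baseChange_induction K (by simp) (fun x y hx hy => ?_) (fun e b hb => ?_)
      · rw [mul_add, hx, hy, add_mul, mul_add]
      · rw [Algebra.TensorProduct.tmul_mul_tmul, Algebra.TensorProduct.tmul_mul_tmul,
          A.graded_comm m n a ha b hb, mul_comm c e]
        rcases neg_one_pow_eq_or A.carrier (m * n) with h | h <;>
        rcases Nat.even_or_odd (m * n) with h' | h' <;>
        simp [h'.neg_one_pow, TensorProduct.tmul_neg]
  d := A.d.baseChange K
  d_deg n := by
    refine baseChange_induction K (by simp) (fun x y hx hy => ?_) (fun c a ha => ?_)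
    · rw [map_add]
      exact add_mem hx hy
    · exact Submodule.tmul_mem_baseChange_of_mem _ (A.d_deg n a ha)
  d_d x := by
    induction x using TensorProduct.induction_on with
    | zero => simp
    | tmul c a => simp [A.d_d]
    | add x y hx hy => rw [map_add, map_add, hx, hy, add_zero]
  leibniz n := by
    refine baseChange_induction K (by simp) (fun x y hx hy b => ?_) (fun c a ha b => ?_)
    · rw [add_mul, map_add, hx b, hy b, map_add, add_mul, add_mul, mul_add]
      abel
    · induction b using TensorProduct.induction_on with
      | zero => simp
      | tmul e b =>
        simp only [Algebra.TensorProduct.tmul_mul_tmul, LinearMap.baseChange_tmul,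
          A.leibniz n a ha b, TensorProduct.tmul_add]
        rcases Nat.even_or_odd n with h' | h' <;>
        simp [h'.neg_one_pow, TensorProduct.tmul_neg]
      | add x y hx hy =>
        rw [mul_add, map_add, hx, hy, map_add, mul_add, mul_add, mul_add]
        abel
  W p := (A.W p).baseChange K
  W_mono p q h := Submodule.baseChange_mono K (A.W_mono h)
  W_graded p n := by
    refine baseChange_induction K (by simp) (fun x y hx hy => ?_) (fun c a ha => ?_)
    · rw [map_add]
      exact add_mem hx hy
    · rw [proj_baseChange, LinearMap.baseChange_tmul]
      exact Submodule.tmul_mem_baseChange_of_mem _ (A.W_graded p n a ha)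
  W_d p := by
    refine baseChange_induction K (by simp) (fun x y hx hy => ?_) (fun c a ha => ?_)
    · rw [map_add]
      exact add_mem hx hy
    · exact Submodule.tmul_mem_baseChange_of_mem _ (A.W_d p a ha)
  W_one := Submodule.tmul_mem_baseChange_of_mem _ A.W_one
  W_mul p q := by
    refine baseChange_induction K (by simp) (fun x y hx hy b hb => ?_) (fun c a ha => ?_)
    · rw [add_mul]
      exact add_mem (hx b hb) (hy b hb)
    · refine baseChange_induction K (by simp) (fun x y hx hy => ?_) (fun e b hb => ?_)
      · rw [mul_add]
        exact add_mem hx hy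
      · rw [Algebra.TensorProduct.tmul_mul_tmul]
        exact Submodule.tmul_mem_baseChange_of_mem _ (A.W_mul p q a ha b hb)
  W_exhaustive x := by
    induction x using TensorProduct.induction_on with
    | zero => exact ⟨0, zero_mem _⟩
    | tmul c a =>
      obtain ⟨p, hp⟩ := A.W_exhaustive a
      exact ⟨p, Submodule.tmul_mem_baseChange_of_mem _ hp⟩
    | add x y hx hy =>
      obtain ⟨p, hp⟩ := hx
      obtain ⟨q, hq⟩ := hy
      exact ⟨max p q, add_mem
        (Submodule.baseChange_mono K (A.W_mono (le_max_left p q)) hp)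
        (Submodule.baseChange_mono K (A.W_mono (le_max_right p q)) hq)⟩
  W_regular n := by
    obtain ⟨q, hq⟩ := A.W_regular n
    refine ⟨q, (Submodule.eq_bot_iff _).2 ?_⟩
    rintro x ⟨hxW, hxn⟩
    have hx : GradedAlgebra.proj (fun i => (A.deg i).baseChange K) n x = x := by
      rw [GradedAlgebra.proj_apply,
        DirectSum.decompose_of_mem_same (fun i => (A.deg i).baseChange K) hxn]
    rw [← hx, proj_baseChange]
    clear hx hxn
    revert x
    refine baseChange_induction K (by simp) (fun x y hx hy => ?_) (fun c a ha => ?_)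
    · rw [map_add, hx, hy, add_zero]
    · have h : GradedAlgebra.proj A.deg n a ∈ A.W q ⊓ A.deg n :=
        ⟨A.W_graded q n a ha, by rw [GradedAlgebra.proj_apply]; exact SetLike.coe_mem _⟩
      rw [hq, Submodule.mem_bot] at h
      rw [LinearMap.baseChange_tmul, h, TensorProduct.tmul_zero]

theorem algHom_baseChange_mem {R S : Type*} [Ring R] [Algebra k R] [Ring S] [Algebra k S]
    (φ : R →ₐ[k] S) {P : Submodule k R} {Q : Submodule k S} (h : ∀ a ∈ P, φ a ∈ Q) :
    ∀ x ∈ P.baseChange K, Algebra.TensorProduct.map (AlgHom.id K K) φ x ∈ Q.baseChange K := by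
  refine baseChange_induction K (by simp) (fun x y hx hy => ?_) (fun c a ha => ?_)
  · rw [map_add]
    exact add_mem hx hy
  · exact Submodule.tmul_mem_baseChange_of_mem _ (h a ha)

theorem algHom_baseChange_comm {R S : Type*} [Ring R] [Algebra k R] [Ring S] [Algebra k S]
    (φ : R →ₐ[k] S) (d : R →ₗ[k] R) (e : S →ₗ[k] S) (h : ∀ a, φ (d a) = e (φ a))
    (x : K ⊗[k] R) :
    Algebra.TensorProduct.map (AlgHom.id K K) φ (d.baseChange K x)
      = e.baseChange K (Algebra.TensorProduct.map (AlgHom.id K K) φ x) := by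
  induction x using TensorProduct.induction_on with
  | zero => simp
  | tmul c a => simp [h]
  | add x y hx hy => simp only [map_add, hx, hy]

/-- Extension of scalars `f ⊗ₖ K` of a morphism. -/
noncomputable def Hom.baseChange {A B : FilteredCDGA k} (f : A.Hom B) :
    (A.baseChange K).Hom (B.baseChange K) where
  toAlgHom := Algebra.TensorProduct.map (AlgHom.id K K) f.toAlgHom
  map_deg n := algHom_baseChange_mem K f.toAlgHom (f.map_deg n)
  map_d := algHom_baseChange_comm K f.toAlgHom A.d B.d f.map_d
  map_W p := algHom_baseChange_mem K f.toAlgHom (f.map_W p)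

end BaseChange

section Cofibrant

variable {k : Type*} [Field k]

/-- The relations `v w = (-1)^(n n) w v` for `v, w ∈ V` placed in degree `n`. -/
inductive FreeRel (n : ℕ) (V : Type*) [AddCommGroup V] [Module k V] :
    TensorAlgebra k V → TensorAlgebra k V → Prop
  | comm (v w : V) : FreeRel n V (TensorAlgebra.ι k v * TensorAlgebra.ι k w)
      ((-1) ^ (n * n) * (TensorAlgebra.ι k w * TensorAlgebra.ι k v))

/-- The free graded-commutative algebra `Λ V` on a vector space `V` placed in degree `n`
(in characteristic `0`: the symmetric algebra for even `n`, the exterior algebra for odd `n`). -/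
abbrev Free (k : Type*) [Field k] (n : ℕ) (V : Type*) [AddCommGroup V] [Module k V] :=
  RingQuot (FreeRel (k := k) n V)

/-- The algebra morphism `Λ V → B` extending the inclusion of a subspace `V` of `Bⁿ`. -/
noncomputable def freeLift (B : FilteredCDGA k) (n : ℕ) (V : Submodule k B.carrier)
    (hV : V ≤ B.deg n) : Free k n V →ₐ[k] B.carrier :=
  RingQuot.liftAlgHom k ⟨TensorAlgebra.lift k V.subtype, by
    rintro _ _ ⟨v, w⟩
    simpa using B.graded_comm n n v (hV v.2) w (hV w.2)⟩

/-- `i : A → B` exhibits `B` as an `E_r`-cofibrant extension `A ⊗_ξ Λ V` of `A` of degree `n` and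
weight `p`. Here `V` is a subspace of `Bⁿ`; multiplication `A ⊗ Λ V → B` is bijective; the
differential of `B` restricts to a map `ξ : V → W_{p-r} A`; and the filtration of `B` is the
multiplicative extension of that of `A`, with `V` in pure weight `p`. The grading, the product and
the differential of `B` are then determined by those of `A`, by `V`, `n` and `ξ`. -/
def IsCofibrantExtension (r : ℕ) {A B : FilteredCDGA k} (i : A.Hom B) (n : ℕ) (p : ℤ) : Prop :=
  ∃ (V : Submodule k B.carrier) (hV : V ≤ B.deg n),
    Function.Bijective (TensorProduct.lift
      ((LinearMap.mul k B.carrier).compl₁₂ i.toAlgHom.toLinearMap (freeLift B n V hV).toLinearMap)) ∧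
    (∃ ξ : V →ₗ[k] A.carrier, (∀ v, ξ v ∈ A.W (p - r) ⊓ A.deg (n + 1)) ∧ (∀ v, A.d (ξ v) = 0) ∧
      ∀ v : V, B.d v = i.toAlgHom (ξ v)) ∧
    ∀ m : ℤ, B.W m = ⨆ j : ℕ, (A.W (m - j * p)).map i.toAlgHom.toLinearMap * V ^ j

/-- `A` is the base field `k` with its trivial filtration (and hence degree `0`, differential `0`),
up to isomorphism. -/
def IsBaseField (A : FilteredCDGA k) : Prop :=
  Function.Bijective (algebraMap k A.carrier) ∧
    ∀ p : ℤ, A.W p = if 0 ≤ p then ⊤ else ⊥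

/-- `A` is an `E_r`-cofibrant dga: the colimit of a sequence `A₀ → A₁ → ⋯` of `E_r`-cofibrant
extensions (of arbitrary degrees and weights) starting from `A₀ = k`. As the maps of the sequence are
injective, the colimit of filtered algebras is the union: the maps `A_j → A` are compatible,
injective, and jointly surjective on every step of the (exhaustive) filtration.
Finite sequences are included, as `V = 0` is allowed in an extension. -/
def IsCofibrant {k : Type u} [Field k] (r : ℕ) (A : FilteredCDGA.{u, v} k) : Prop :=
  ∃ (X : ℕ → FilteredCDGA.{u, v} k) (i : ∀ j, (X j).Hom (X (j + 1))) (c : ∀ j, (X j).Hom A),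
    (X 0).IsBaseField ∧
    (∀ j, ∃ (n : ℕ) (p : ℤ), IsCofibrantExtension r (i j) n p) ∧
    (∀ j, (c (j + 1)).toAlgHom.comp (i j).toAlgHom = (c j).toAlgHom) ∧
    (∀ j, Function.Injective (c j).toAlgHom) ∧
    ∀ m : ℤ, ∀ a ∈ A.W m, ∃ j, ∃ x ∈ (X j).W m, (c j).toAlgHom x = a

/-- `A` is finitely generated as an algebra. -/
def IsFinitelyGenerated (A : FilteredCDGA k) : Prop :=
  Algebra.FiniteType k A.carrier

end Cofibrant

section Splitting

variable {k : Type*} [Field k]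

/-- The family `S p q = A^{p,q}` of subspaces is an `r`-splitting of `A`. -/
structure IsSplitting (r : ℕ) (A : FilteredCDGA k) (S : ℤ → ℤ → Submodule k A.carrier) : Prop where
  isInternal : DirectSum.IsInternal (fun pq : ℤ × ℤ => S pq.1 pq.2)
  d_mem : ∀ p q : ℤ, ∀ a ∈ S p q, A.d a ∈ S (p + r) (q - r + 1)
  mul_mem : ∀ p q p' q' : ℤ, ∀ a ∈ S p q, ∀ b ∈ S p' q', a * b ∈ S (p + p') (q + q')
  W_eq : ∀ (m : ℤ) (n : ℕ), A.W m ⊓ A.deg n = ⨆ (p : ℤ) (_ : p ≤ m), S (-p) (n + p)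

/-- The morphism `f : A → B` admits an `r`-splitting: `A` and `B` admit `r`-splittings with which `f`
is compatible. -/
def Hom.AdmitsSplitting (r : ℕ) {A B : FilteredCDGA k} (f : A.Hom B) : Prop :=
  ∃ (S : ℤ → ℤ → Submodule k A.carrier) (T : ℤ → ℤ → Submodule k B.carrier),
    IsSplitting r A S ∧ IsSplitting r B T ∧
      ∀ p q : ℤ, ∀ a ∈ S p q, f.toAlgHom a ∈ T p q

end Splitting

end FilteredCDGA

/-! An `r`-splitting is encoded by a single operator: let `θ` multiply `A^{p,q}` by the weight `-p`.
Multiplicativity of the splitting makes `θ` a derivation, the bidegree of `d` gives `[θ, d] = -r d`,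
and the formula for `W` says that `θ` acts as `m` on `W m / W (m - 1)`.

Conversely, such a `θ` is automatically diagonalizable. In a fixed degree the filtration vanishes
far enough down, and distinct integers stay distinct in characteristic `0`, so `W m` is split off
one weight at a time. The eigenspaces, cut by degree, form an `r`-splitting
(`IsWeightDerivation.isSplitting`). Hence `f` admits an `r`-splitting exactly when it intertwines
two weight derivations (`Hom.admitsSplitting_iff`).

The conditions on such a pair are affine linear with coefficients in `k`, so solvability does not
depend on the field. Concretely, a `k`-linear retraction `π : K → k` with `π 1 = 1` turns a solution
over `K` into one over `k`, namely `a ↦ π (Θ (1 ⊗ a))` (`IsWeightDerivation.descend`). -/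

namespace FilteredCDGA

/-- A weight derivation of `A`: a derivation `θ` of degree `0` of the underlying algebra which acts
as multiplication by `m` on each graded piece `W m / W (m - 1)` and satisfies `[θ, d] = -r d`.
In characteristic `0` these are the infinitesimal generators of `r`-splittings. All conditions are
affine in `θ`. -/
structure IsWeightDerivation {k : Type*} [Field k] (r : ℕ) (A : FilteredCDGA k)
    (θ : A.carrier →ₗ[k] A.carrier) : Prop where
  map_deg : ∀ n : ℕ, ∀ a ∈ A.deg n, θ a ∈ A.deg n
  map_mul : ∀ a b, θ (a * b) = θ a * b + a * θ b
  map_W : ∀ m : ℤ, ∀ a ∈ A.W m, θ a - (m : k) • a ∈ A.W (m - 1)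
  map_d : ∀ a, θ (A.d a) = A.d (θ a) - (r : k) • A.d a

/-! ### Splittings versus weight derivations -/

section

variable {k : Type*} [Field k] {A : FilteredCDGA k} {r : ℕ}

theorem proj_mem_deg (n : ℕ) (a : A.carrier) : GradedAlgebra.proj A.deg n a ∈ A.deg n := by
  rw [GradedAlgebra.proj_apply]
  exact SetLike.coe_mem _

theorem proj_of_mem {n : ℕ} {a : A.carrier} (ha : a ∈ A.deg n) :
    GradedAlgebra.proj A.deg n a = a := by
  rw [GradedAlgebra.proj_apply, DirectSum.decompose_of_mem_same _ ha]

theorem proj_of_mem_ne {m n : ℕ} {a : A.carrier} (ha : a ∈ A.deg m) (h : m ≠ n) :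
    GradedAlgebra.proj A.deg n a = 0 := by
  rw [GradedAlgebra.proj_apply, DirectSum.decompose_of_mem_ne _ ha h]

theorem sum_proj (a : A.carrier) :
    ∃ s : Finset ℕ, ∑ n ∈ s, GradedAlgebra.proj A.deg n a = a := by
  classical
  exact ⟨_, by simpa only [GradedAlgebra.proj_apply] using DirectSum.sum_support_decompose A.deg a⟩

theorem IsSplitting.exists_linearMap {S : ℤ → ℤ → Submodule k A.carrier}
    (hS : DirectSum.IsInternal (fun pq : ℤ × ℤ => S pq.1 pq.2)) :
    ∃ θ : A.carrier →ₗ[k] A.carrier, ∀ p q : ℤ, ∀ a ∈ S p q, θ a = ((-p : ℤ) : k) • a := by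
  classical
  let e := LinearEquiv.ofBijective
    (DirectSum.coeLinearMap (fun pq : ℤ × ℤ => S pq.1 pq.2)) hS
  refine ⟨DirectSum.toModule k (ℤ × ℤ) A.carrier
    (fun pq => ((-pq.1 : ℤ) : k) • (S pq.1 pq.2).subtype) ∘ₗ e.symm.toLinearMap,
    fun p q a ha => ?_⟩
  have h : e.symm a = DirectSum.lof k (ℤ × ℤ) (fun pq => S pq.1 pq.2) (p, q) ⟨a, ha⟩ := by
    rw [LinearEquiv.symm_apply_eq]
    exact (DirectSum.coeLinearMap_lof (fun pq : ℤ × ℤ => S pq.1 pq.2) (p, q) ⟨a, ha⟩).symm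
  simp [h]

theorem IsSplitting.le_deg {S : ℤ → ℤ → Submodule k A.carrier} (hS : IsSplitting r A S)
    (p : ℤ) (n : ℕ) : S (-p) (n + p) ≤ A.W p ⊓ A.deg n := by
  rw [hS.W_eq]
  exact le_iSup₂_of_le p le_rfl le_rfl

/-- Induction on the bihomogeneous components of an element of `W m`. -/
theorem IsSplitting.W_induction {S : ℤ → ℤ → Submodule k A.carrier} (hS : IsSplitting r A S)
    {m : ℤ} {P : Submodule k A.carrier} (h : ∀ (n : ℕ) (p : ℤ), p ≤ m → S (-p) (n + p) ≤ P) :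
    A.W m ≤ P := by
  intro a ha
  obtain ⟨s, hs⟩ := sum_proj a
  rw [← hs]
  refine sum_mem fun n _ => ?_
  have hn : GradedAlgebra.proj A.deg n a ∈ A.W m ⊓ A.deg n :=
    ⟨A.W_graded m n a ha, proj_mem_deg n a⟩
  rw [hS.W_eq] at hn
  exact (iSup₂_le fun p hp => h n p hp) hn

theorem IsSplitting.induction {S : ℤ → ℤ → Submodule k A.carrier} (hS : IsSplitting r A S)
    {P : Submodule k A.carrier} (h : ∀ p q : ℤ, S p q ≤ P) (a : A.carrier) : a ∈ P := by
  obtain ⟨m, hm⟩ := A.W_exhaustive a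
  exact hS.W_induction (fun n p _ => h _ _) hm

/-- The derivation that multiplies by the weight in a splitting. -/
theorem IsSplitting.isWeightDerivation {S : ℤ → ℤ → Submodule k A.carrier}
    (hS : IsSplitting r A S) {θ : A.carrier →ₗ[k] A.carrier}
    (hθ : ∀ p q : ℤ, ∀ a ∈ S p q, θ a = ((-p : ℤ) : k) • a) : IsWeightDerivation r A θ where
  map_deg n a ha := by
    obtain ⟨m, hm⟩ := A.W_exhaustive a
    have h : a ∈ A.W m ⊓ A.deg n := ⟨hm, ha⟩
    rw [hS.W_eq] at h
    refine (iSup₂_le fun p _ b hb => ?_ :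
      (⨆ (p : ℤ) (_ : p ≤ m), S (-p) (n + p)) ≤ (A.deg n).comap θ) h
    rw [Submodule.mem_comap, hθ _ _ b hb]
    exact Submodule.smul_mem _ _ (hS.le_deg p n hb).2
  map_mul a b := by
    -- Both sides are bilinear in `a` and `b`, so bihomogeneous elements suffice; there the weights
    -- add.
    have key : ∀ p q : ℤ, ∀ a ∈ S p q, θ (a * b) = θ a * b + a * θ b := fun p q a ha =>
      hS.induction (P := LinearMap.eqLocus (θ ∘ₗ LinearMap.mulLeft k a)
          (LinearMap.mulLeft k (θ a) + LinearMap.mulLeft k a ∘ₗ θ)) (fun p' q' b hb => by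
        simp only [LinearMap.mem_eqLocus, LinearMap.comp_apply, LinearMap.add_apply,
          LinearMap.mulLeft_apply]
        rw [hθ _ _ _ (hS.mul_mem _ _ _ _ a ha b hb), hθ _ _ a ha, hθ _ _ b hb, smul_mul_assoc,
          mul_smul_comm, ← add_smul]
        push_cast
        congr 1
        ring) b
    exact hS.induction (P := LinearMap.eqLocus (θ ∘ₗ LinearMap.mulRight k b)
      (LinearMap.mulRight k b ∘ₗ θ + LinearMap.mulRight k (θ b))) key a
  map_W m a ha := by
    refine hS.W_induction (P := (A.W (m - 1)).comap (θ - (m : k) • LinearMap.id))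
      (fun n p hp b hb => ?_) ha
    simp only [Submodule.mem_comap, LinearMap.sub_apply, LinearMap.smul_apply, LinearMap.id_apply]
    rw [hθ _ _ b hb, neg_neg]
    -- The component of weight exactly `m` is killed; those of lower weight already lie in `W (m -
    -- 1)`.
    rcases hp.eq_or_lt with rfl | hlt
    · simp
    · have hb' := A.W_mono (Int.le_sub_one_of_lt hlt) (hS.le_deg p n hb).1
      exact sub_mem (Submodule.smul_mem _ _ hb') (Submodule.smul_mem _ _ hb')
  map_d a := by
    refine hS.induction (P := LinearMap.eqLocus (θ ∘ₗ A.d) (A.d ∘ₗ θ - (r : k) • A.d))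
      (fun p q b hb => ?_) a
    simp only [LinearMap.mem_eqLocus, LinearMap.comp_apply, LinearMap.sub_apply,
      LinearMap.smul_apply]
    rw [hθ _ _ _ (hS.d_mem p q b hb), hθ _ _ b hb, map_smul, ← sub_smul]
    push_cast
    congr 1
    ring

/-! ### The bigrading by eigenspaces and degree -/

variable (A) in
/-- The degrees of `A`, extended by `0` to negative integers. -/
def intDeg : ℤ → Submodule k A.carrier
  | Int.ofNat n => A.deg n
  | Int.negSucc _ => ⊥

theorem intDeg_natCast (n : ℕ) : A.intDeg n = A.deg n := rfl

theorem mem_intDeg {z : ℤ} {a : A.carrier} :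
    a ∈ A.intDeg z ↔ a = 0 ∨ ∃ n : ℕ, z = n ∧ a ∈ A.deg n := by
  constructor
  · cases z with
    | ofNat n => exact fun h => Or.inr ⟨n, rfl, h⟩
    | negSucc n => exact fun h => Or.inl h
  · rintro (rfl | ⟨n, rfl, h⟩)
    · exact zero_mem _
    · exact h

variable (A) in
/-- The bigrading of `A` by the eigenspaces of an endomorphism and the degree. -/
def eigenBigrading (θ : A.carrier →ₗ[k] A.carrier) (p q : ℤ) : Submodule k A.carrier :=
  Module.End.eigenspace θ ((-p : ℤ) : k) ⊓ A.intDeg (p + q)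

theorem mem_eigenBigrading {θ : A.carrier →ₗ[k] A.carrier} {p q : ℤ} {a : A.carrier} :
    a ∈ A.eigenBigrading θ p q ↔ θ a = ((-p : ℤ) : k) • a ∧ a ∈ A.intDeg (p + q) := by
  rw [eigenBigrading, Submodule.mem_inf, Module.End.mem_eigenspace_iff]

/-- Passes from the bidegree `(p, q)` to weight and degree, the coordinates in which a splitting
describes `W`. -/
theorem mem_eigenBigrading_neg {θ : A.carrier →ₗ[k] A.carrier} {p : ℤ} {n : ℕ} {a : A.carrier} :
    a ∈ A.eigenBigrading θ (-p) (n + p) ↔ θ a = (p : k) • a ∧ a ∈ A.deg n := by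
  rw [mem_eigenBigrading, neg_neg, neg_add_eq_sub, add_sub_cancel_right, intDeg_natCast]

variable [CharZero k]

theorem iSupIndep_eigenBigrading (θ : A.carrier →ₗ[k] A.carrier) :
    iSupIndep (fun pq : ℤ × ℤ => A.eigenBigrading θ pq.1 pq.2) := by
  rintro ⟨p, q⟩
  rw [Submodule.disjoint_def]
  intro a ha ha'
  rw [mem_eigenBigrading] at ha
  obtain ⟨hp, hpq⟩ := ha
  rcases mem_intDeg.1 hpq with h0 | ⟨n, hn, han⟩
  · exact h0
  have h := (Submodule.disjoint_def.1 (Module.End.eigenspaces_iSupIndep θ ((-p : ℤ) : k))) a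
    (Module.End.mem_eigenspace_iff.2 hp)
  refine h ?_
  -- Independence of eigenspaces only separates different `p`. Projecting to degree `n` removes the
  -- pieces with `p' + q' ≠ n`; any other piece that survives must have `p' ≠ p`.
  rw [← proj_of_mem han]
  refine (iSup₂_le fun pq hne b hb => ?_ :
    (⨆ (pq : ℤ × ℤ) (_ : pq ≠ (p, q)), A.eigenBigrading θ pq.1 pq.2) ≤
      Submodule.comap (GradedAlgebra.proj A.deg n)
        (⨆ (c : k) (_ : c ≠ ((-p : ℤ) : k)), Module.End.eigenspace θ c)) ha'
  rw [Submodule.mem_comap]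
  rw [mem_eigenBigrading] at hb
  rcases mem_intDeg.1 hb.2 with h0 | ⟨n', hn', hbn⟩
  · rw [h0, map_zero]
    exact zero_mem _
  by_cases hnn : n' = n
  · subst hnn
    rw [proj_of_mem hbn]
    have hpp : ((-pq.1 : ℤ) : k) ≠ ((-p : ℤ) : k) := fun h => hne (by
      have h1 : pq.1 = p := by simpa using h
      exact Prod.ext h1 (by simp only; omega))
    exact Submodule.mem_iSup_of_mem _ (Submodule.mem_iSup_of_mem hpp
      (Module.End.mem_eigenspace_iff.2 hb.1))
  · rw [proj_of_mem_ne hbn hnn]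
    exact zero_mem _

namespace IsWeightDerivation

variable {θ : A.carrier →ₗ[k] A.carrier} (hθ : IsWeightDerivation r A θ)
include hθ

/-- If `a` lies in `W (M + 1)` with `M ≥ p`, then `θ a - (M + 1) a = (p - M - 1) a` lies in `W M`,
and the scalar is nonzero. Exhaustiveness starts this descent, which stops at `W p`. -/
theorem mem_W_of_eigenvector {p : ℤ} {a : A.carrier} (ha : θ a = (p : k) • a) : a ∈ A.W p := by
  obtain ⟨M, hM⟩ := A.W_exhaustive a
  rcases le_total M p with h | h
  · exact A.W_mono h hM
  revert hM
  induction M, h using Int.leInduction with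
  | base => exact id
  | succ M hpM ih =>
    intro hM
    have h := hθ.map_W _ a hM
    rw [ha, ← sub_smul, add_sub_cancel_right] at h
    refine ih ((Submodule.smul_mem_iff _ ?_).1 h)
    rw [← Int.cast_sub]
    exact Int.cast_ne_zero.2 (by omega)

/-- Diagonalizability of `θ` in each degree, by induction on `m` upwards from a step where
regularity makes the filtration zero. -/
theorem W_inf_deg_eq (m : ℤ) (n : ℕ) :
    A.W m ⊓ A.deg n = ⨆ (p : ℤ) (_ : p ≤ m), A.eigenBigrading θ (-p) (n + p) := by
  apply le_antisymm
  · obtain ⟨q, hq⟩ := A.W_regular n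
    rcases le_total m q with h | h
    · exact ((inf_le_inf_right _ (A.W_mono h)).trans hq.le).trans bot_le
    induction m, h using Int.leInduction with
    | base => exact hq.le.trans bot_le
    | succ m _ ih =>
      rintro a ⟨haW, han⟩
      have hb : θ a - ((m + 1 : ℤ) : k) • a ∈
          ⨆ (p : ℤ) (_ : p ≤ m), A.eigenBigrading θ (-p) (n + p) := by
        refine ih ⟨?_, sub_mem (hθ.map_deg n a han) (Submodule.smul_mem _ _ han)⟩
        have h := hθ.map_W _ a haW
        rwa [add_sub_cancel_right] at h
      -- All eigenvalues on the lower step differ from `m + 1`, so `θ - (m + 1)` can be inverted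
      -- there by dividing each eigencomponent. With `c` the preimage of `(θ - (m + 1)) a`, the
      -- difference `a - c` is an eigenvector of weight `m + 1`.
      obtain ⟨c, hc, hcb⟩ := (iSup₂_le fun p hp b hb => by
        refine ⟨((p : k) - ((m + 1 : ℤ) : k))⁻¹ • b,
          Submodule.smul_mem _ _ (Submodule.mem_iSup_of_mem p (Submodule.mem_iSup_of_mem hp hb)), ?_⟩
        have h0 : (p : k) - ((m + 1 : ℤ) : k) ≠ 0 := by
          rw [← Int.cast_sub]
          exact Int.cast_ne_zero.2 (by omega)
        simp only [LinearMap.sub_apply, LinearMap.smul_apply, LinearMap.id_apply, map_smul]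
        rw [(mem_eigenBigrading_neg.1 hb).1, ← sub_smul,
          inv_smul_smul₀ h0] :
        (⨆ (p : ℤ) (_ : p ≤ m), A.eigenBigrading θ (-p) (n + p)) ≤
          (⨆ (p : ℤ) (_ : p ≤ m), A.eigenBigrading θ (-p) (n + p)).map
            (θ - ((m + 1 : ℤ) : k) • LinearMap.id)) hb
      have hcn : c ∈ A.deg n :=
        (iSup₂_le fun p _ b hb => (mem_eigenBigrading_neg.1 hb).2 :
          (⨆ (p : ℤ) (_ : p ≤ m), A.eigenBigrading θ (-p) (n + p)) ≤ A.deg n) hc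
      simp only [LinearMap.sub_apply, LinearMap.smul_apply, LinearMap.id_apply] at hcb
      rw [← sub_add_cancel a c]
      refine add_mem (Submodule.mem_iSup_of_mem (m + 1) (Submodule.mem_iSup_of_mem le_rfl
        (mem_eigenBigrading_neg.2 ⟨?_, sub_mem han hcn⟩))) ?_
      · rw [map_sub, smul_sub, ← sub_eq_zero]
        rw [← sub_eq_zero] at hcb
        rw [← neg_eq_zero, ← hcb]
        abel
      · exact (iSup_mono fun p => iSup_mono' fun hp => ⟨hp.trans (by omega), le_rfl⟩ :
          (⨆ (p : ℤ) (_ : p ≤ m), A.eigenBigrading θ (-p) (n + p)) ≤ _) hc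
  · refine iSup₂_le fun p hp a ha => ?_
    rw [mem_eigenBigrading_neg] at ha
    exact ⟨A.W_mono hp (hθ.mem_W_of_eigenvector ha.1), ha.2⟩

theorem isSplitting : IsSplitting r A (A.eigenBigrading θ) where
  isInternal := by
    classical
    rw [DirectSum.isInternal_submodule_iff_iSupIndep_and_iSup_eq_top]
    refine ⟨iSupIndep_eigenBigrading θ, eq_top_iff.2 fun a _ => ?_⟩
    obtain ⟨m, hm⟩ := A.W_exhaustive a
    obtain ⟨s, hs⟩ := sum_proj a
    rw [← hs]
    refine sum_mem fun n _ => ?_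
    have hn : GradedAlgebra.proj A.deg n a ∈ A.W m ⊓ A.deg n :=
      ⟨A.W_graded m n a hm, proj_mem_deg n a⟩
    rw [hθ.W_inf_deg_eq] at hn
    exact (iSup₂_le fun p _ =>
      le_iSup (fun pq : ℤ × ℤ => A.eigenBigrading θ pq.1 pq.2) (-p, n + p)) hn
  d_mem p q a ha := by
    rw [mem_eigenBigrading] at ha ⊢
    refine ⟨?_, ?_⟩
    · rw [hθ.map_d, ha.1, map_smul, ← sub_smul]
      push_cast
      congr 1
      ring
    · rw [mem_intDeg]
      rcases mem_intDeg.1 ha.2 with rfl | ⟨n, hn, han⟩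
      · exact Or.inl (map_zero _)
      · exact Or.inr ⟨n + 1, by push_cast; omega, A.d_deg n a han⟩
  mul_mem p q p' q' a ha b hb := by
    rw [mem_eigenBigrading] at ha hb ⊢
    refine ⟨?_, ?_⟩
    · rw [hθ.map_mul, ha.1, hb.1, smul_mul_assoc, mul_smul_comm, ← add_smul]
      push_cast
      congr 1
      ring
    · rw [mem_intDeg]
      rcases mem_intDeg.1 ha.2 with rfl | ⟨n, hn, han⟩
      · exact Or.inl (zero_mul _)
      rcases mem_intDeg.1 hb.2 with rfl | ⟨n', hn', hbn⟩
      · exact Or.inl (mul_zero _)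
      · exact Or.inr ⟨n + n', by push_cast; omega, SetLike.mul_mem_graded han hbn⟩
  W_eq := hθ.W_inf_deg_eq

end IsWeightDerivation

/-- A morphism admits an `r`-splitting if and only if it intertwines weight derivations. -/
theorem Hom.admitsSplitting_iff {B : FilteredCDGA k} (f : A.Hom B) :
    f.AdmitsSplitting r ↔ ∃ (θ : A.carrier →ₗ[k] A.carrier) (η : B.carrier →ₗ[k] B.carrier),
      IsWeightDerivation r A θ ∧ IsWeightDerivation r B η ∧
        ∀ a, f.toAlgHom (θ a) = η (f.toAlgHom a) := by
  constructor
  · rintro ⟨S, T, hS, hT, hf⟩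
    obtain ⟨θ, hθ⟩ := IsSplitting.exists_linearMap hS.isInternal
    obtain ⟨η, hη⟩ := IsSplitting.exists_linearMap hT.isInternal
    refine ⟨θ, η, hS.isWeightDerivation hθ, hT.isWeightDerivation hη,
      hS.induction (P := LinearMap.eqLocus (f.toAlgHom.toLinearMap ∘ₗ θ)
        (η ∘ₗ f.toAlgHom.toLinearMap)) fun p q a ha => ?_⟩
    simp only [LinearMap.mem_eqLocus, LinearMap.comp_apply, AlgHom.toLinearMap_apply]
    rw [hθ _ _ a ha, hη _ _ _ (hf _ _ a ha), map_smul]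
  · rintro ⟨θ, η, hθ, hη, hf⟩
    refine ⟨_, _, hθ.isSplitting, hη.isSplitting, fun p q a ha => ?_⟩
    rw [mem_eigenBigrading] at ha ⊢
    refine ⟨by rw [← hf, ha.1, map_smul], ?_⟩
    rw [mem_intDeg]
    rcases mem_intDeg.1 ha.2 with rfl | ⟨n, hn, han⟩
    · exact Or.inl (map_zero _)
    · exact Or.inr ⟨n, hn, f.map_deg n a han⟩

end

/-! ### Extension of scalars and descent of weight derivations -/

section Descent

variable {k : Type*} [Field k] (K : Type*) [Field K] [Algebra k K] {A : FilteredCDGA k} {r : ℕ}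

/-- Extension of scalars of a weight derivation. -/
theorem IsWeightDerivation.baseChange {θ : A.carrier →ₗ[k] A.carrier}
    (hθ : IsWeightDerivation r A θ) :
    IsWeightDerivation r (A.baseChange K) (θ.baseChange K) where
  map_deg n := by
    change ∀ x ∈ (A.deg n).baseChange K, θ.baseChange K x ∈ (A.deg n).baseChange K
    refine baseChange_induction K (by simp) (fun x y hx hy => ?_) (fun c a ha => ?_)
    · rw [map_add]
      exact add_mem hx hy
    · exact Submodule.tmul_mem_baseChange_of_mem _ (hθ.map_deg n a ha)
  map_mul x y := by
    change K ⊗[k] A.carrier at x y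
    change θ.baseChange K (x * y) = θ.baseChange K x * y + x * θ.baseChange K y
    induction x using TensorProduct.induction_on with
    | zero => simp
    | tmul c a =>
      induction y using TensorProduct.induction_on with
      | zero => simp
      | tmul e b => simp [hθ.map_mul, TensorProduct.tmul_add]
      | add x y hx hy =>
        rw [mul_add, map_add, hx, hy, map_add, mul_add, mul_add]
        abel
    | add x z hx hz =>
      rw [add_mul, map_add, hx, hz, map_add, add_mul, add_mul]
      abel
  map_W m := by
    change ∀ x ∈ (A.W m).baseChange K,
      θ.baseChange K x - (m : K) • x ∈ (A.W (m - 1)).baseChange K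
    refine baseChange_induction K (by simp) (fun x y hx hy => ?_) (fun c a ha => ?_)
    · rw [map_add, smul_add, add_sub_add_comm]
      exact add_mem hx hy
    · have h : θ.baseChange K (c ⊗ₜ[k] a) - (m : K) • c ⊗ₜ[k] a
          = c ⊗ₜ[k] (θ a - (m : k) • a) := by
        rw [LinearMap.baseChange_tmul, TensorProduct.tmul_sub, TensorProduct.tmul_smul,
          Int.cast_smul_eq_zsmul, Int.cast_smul_eq_zsmul]
      exact h ▸ Submodule.tmul_mem_baseChange_of_mem _ (hθ.map_W m a ha)
  map_d x := by
    change K ⊗[k] A.carrier at x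
    change θ.baseChange K (A.d.baseChange K x) =
      A.d.baseChange K (θ.baseChange K x) - (r : K) • A.d.baseChange K x
    induction x using TensorProduct.induction_on with
    | zero => simp
    | tmul c a =>
      simp only [LinearMap.baseChange_tmul, hθ.map_d, TensorProduct.tmul_sub,
        TensorProduct.tmul_smul, Nat.cast_smul_eq_nsmul]
    | add x y hx hy =>
      simp only [map_add, hx, hy, smul_add]
      abel

/-- The map `K ⊗ M → M` induced by a linear form on `K`. -/
noncomputable def contract {K : Type*} [Field K] [Algebra k K] (π : K →ₗ[k] k) (M : Type*)
    [AddCommGroup M] [Module k M] : K ⊗[k] M →ₗ[k] M :=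
  (TensorProduct.lid k M).toLinearMap ∘ₗ π.rTensor M

variable {K} (π : K →ₗ[k] k)

@[simp]
theorem contract_tmul {M : Type*} [AddCommGroup M] [Module k M] (c : K) (a : M) :
    contract π M (c ⊗ₜ a) = π c • a := by
  simp [contract]

theorem contract_baseChange {M N : Type*} [AddCommGroup M] [Module k M] [AddCommGroup N]
    [Module k N] (g : M →ₗ[k] N) (x : K ⊗[k] M) :
    contract π N (g.baseChange K x) = g (contract π M x) := by
  induction x using TensorProduct.induction_on with
  | zero => simp
  | tmul c a => simp
  | add x y hx hy => simp only [map_add, hx, hy]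

theorem contract_mem {M : Type*} [AddCommGroup M] [Module k M] {S : Submodule k M} :
    ∀ x ∈ S.baseChange K, contract π M x ∈ S := by
  refine baseChange_induction K (by simp) (fun x y hx hy => ?_) (fun c a ha => ?_)
  · rw [map_add]
    exact add_mem hx hy
  · rw [contract_tmul]
    exact S.smul_mem _ ha

/-- The form `π` need not be multiplicative, but contraction is still linear over `1 ⊗ R` on either
side, which is all the Leibniz rule requires. -/
theorem contract_mul_right {R : Type*} [Ring R] [Algebra k R] (x : K ⊗[k] R) (b : R) :
    contract π R (x * 1 ⊗ₜ b) = contract π R x * b := by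
  induction x using TensorProduct.induction_on with
  | zero => simp
  | tmul c a => simp
  | add x y hx hy => simp only [add_mul, map_add, hx, hy]

theorem contract_mul_left {R : Type*} [Ring R] [Algebra k R] (a : R) (x : K ⊗[k] R) :
    contract π R (1 ⊗ₜ a * x) = a * contract π R x := by
  induction x using TensorProduct.induction_on with
  | zero => simp
  | tmul c b => simp
  | add x y hx hy => simp only [mul_add, map_add, hx, hy]

/-- The endomorphism of `M` obtained from an endomorphism of `K ⊗ M` by contraction. -/
noncomputable def descend {M : Type*} [AddCommGroup M] [Module k M]
    (Θ : K ⊗[k] M →ₗ[K] K ⊗[k] M) : M →ₗ[k] M :=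
  contract π M ∘ₗ Θ.restrictScalars k ∘ₗ TensorProduct.mk k K M 1

theorem descend_apply {M : Type*} [AddCommGroup M] [Module k M]
    (Θ : K ⊗[k] M →ₗ[K] K ⊗[k] M) (a : M) : descend π Θ a = contract π M (Θ (1 ⊗ₜ a)) := rfl

variable {π}

/-- Contraction along a retraction `K → k` turns weight derivations of `A ⊗ K` into weight
derivations of `A`. -/
theorem IsWeightDerivation.descend (hπ : π 1 = 1) {Θ : K ⊗[k] A.carrier →ₗ[K] K ⊗[k] A.carrier}
    (hΘ : IsWeightDerivation r (A.baseChange K) Θ) :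
    IsWeightDerivation r A (descend π Θ) where
  map_deg n a ha := contract_mem π _ (hΘ.map_deg n _ (Submodule.tmul_mem_baseChange_of_mem 1 ha))
  map_mul a b := by
    have h : Θ ((1 ⊗ₜ a) * (1 ⊗ₜ b)) = Θ (1 ⊗ₜ a) * 1 ⊗ₜ b + 1 ⊗ₜ a * Θ (1 ⊗ₜ b) :=
      hΘ.map_mul (1 ⊗ₜ a) (1 ⊗ₜ b)
    rw [Algebra.TensorProduct.tmul_mul_tmul, one_mul] at h
    rw [descend_apply, h, map_add, contract_mul_right, contract_mul_left]
    rfl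
  map_W m a ha := by
    have h : contract π A.carrier (Θ (1 ⊗ₜ a) - (m : K) • 1 ⊗ₜ[k] a) ∈ A.W (m - 1) :=
      contract_mem π _ (hΘ.map_W m _ (Submodule.tmul_mem_baseChange_of_mem 1 ha))
    -- The inhomogeneous term survives because `π 1 = 1`; integer scalars pass from `K` to `k` as
    -- multiples in `ℤ`.
    rwa [map_sub, Int.cast_smul_eq_zsmul, map_zsmul, contract_tmul, hπ, one_smul,
      ← Int.cast_smul_eq_zsmul k] at h
  map_d a := by
    have h : Θ (A.d.baseChange K (1 ⊗ₜ a)) =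
        A.d.baseChange K (Θ (1 ⊗ₜ a)) - (r : K) • A.d.baseChange K (1 ⊗ₜ a) :=
      hΘ.map_d (1 ⊗ₜ a)
    rw [LinearMap.baseChange_tmul] at h
    rw [descend_apply, h, map_sub, contract_baseChange, Nat.cast_smul_eq_nsmul, map_nsmul,
      contract_tmul, hπ, one_smul, Nat.cast_smul_eq_nsmul, descend_apply]

end Descent

end FilteredCDGA

theorem mainTheorem5 {k : Type*} [Field k] [CharZero k] (K : Type*) [Field K] [Algebra k K] (r : ℕ)
    {A : FilteredCDGA k} {B : FilteredCDGA k} (f : A.Hom B)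
    (hA : A.IsCofibrant r) (hA' : A.IsFinitelyGenerated)
    (hB : B.IsCofibrant r) (hB' : B.IsFinitelyGenerated) :
    f.AdmitsSplitting r ↔ (f.baseChange K).AdmitsSplitting r := by
  have : CharZero K := charZero_of_injective_algebraMap (algebraMap k K).injective
  rw [FilteredCDGA.Hom.admitsSplitting_iff, FilteredCDGA.Hom.admitsSplitting_iff]
  constructor
  · rintro ⟨θ, η, hθ, hη, hf⟩
    exact ⟨_, _, hθ.baseChange K, hη.baseChange K,
      FilteredCDGA.algHom_baseChange_comm K f.toAlgHom θ η hf⟩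
  · rintro ⟨Θ, H, hΘ, hH, hf⟩
    -- The inclusion of `k` in `K` splits as a map of vector spaces. The same `π` is used for `A`
    -- and `B`, so naturality of contraction preserves compatibility with `f`.
    obtain ⟨π, hπ⟩ := LinearMap.exists_leftInverse_of_injective (Algebra.linearMap k K)
      (LinearMap.ker_eq_bot.2 (algebraMap k K).injective)
    have h1 : π 1 = 1 := by simpa using LinearMap.congr_fun hπ 1
    refine ⟨_, _, hΘ.descend h1, hH.descend h1, fun a => ?_⟩
    have h : f.toAlgHom.toLinearMap.baseChange K (Θ (1 ⊗ₜ a)) = H (1 ⊗ₜ f.toAlgHom a) :=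
      (hf (1 ⊗ₜ a)).trans (congrArg H (Algebra.TensorProduct.map_tmul ..))
    exact (FilteredCDGA.contract_baseChange π f.toAlgHom.toLinearMap _).symm.trans
      (congrArg (FilteredCDGA.contract π _) h)
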